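/- In the hat guessing game $\langle G,h,g\rangle$ on a finite simple graph $G$, a sage sits at each vertex $v$; an adversary gives $v$ a hat of one of $h(v)$ colors. Each sage sees exactly the hats of the neighboring sages and, by a deterministic strategy fixed in advance, makes $g(v)$ guesses of the color of his or her own hat. The game is winning if some strategy ensures that for every hat placement at least one sage makes a correct guess. For a positive integer $s$, let $\mathrm{HG}_s(G)$ be the largest $k$ such that the game on $G$ with $h\equiv k$ and $g\equiv s$ is winning, and for a class $\mathcal C$ of graphs let $\mathrm{HG}_s(\mathcal C)=\sup\{\mathrm{HG}_s(G): G\in\mathcal C\}$. For $n\ge 1$ the petal $Pe_n$ is the graph obtained from the path $P_n$ on $n$ vertices by adding one vertex adjacent to every vertex of $P_n$; let $\mathcal{P}etal$ be the class of all petals. **Theorem.** For every integer $s\ge 1$, $$\mathrm{HG}_s(\mathcal{P}etal)=4s(s+1)-2.$$ More precisely: (a) $\mathrm{HG}_s(Pe_n)<4s(s+1)-1$ for all $n\ge 1$; (b) there is $N=N(s)$ such that $\mathrm{HG}_s(Pe_n)=4s(s+1)-2$ for all $n\ge N$. -/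

import Mathlib

namespace Hats

/-- A hat guessing game `⟨G, h, g⟩`: the sages sit at the vertices of the visibility graph `G`,
the hat of the sage `v` has one of the colors `0, …, h v - 1`, and `v` is allowed `g v` guesses. -/
structure Game (V : Type*) where
  /-- the visibility graph -/
  graph : SimpleGraph V
  /-- the hatness function -/
  hatness : V → ℕ
  /-- the guessing function -/
  guesses : V → ℕ

/-- A hat placement: every sage `v` gets a hat of one of `h v` colors. -/
abbrev Game.Placement {V : Type*} (𝒢 : Game V) : Type _ :=
  ∀ v : V, Fin (𝒢.hatness v)

/-- A deterministic strategy: every sage `v` writes a list of at most `g v` different colors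
(repetitions in a list of `g v` colors are immaterial), and this list is determined by the colors
of the hats of the neighbors of `v`. -/
structure Game.Strategy {V : Type*} (𝒢 : Game V) where
  /-- the set of colors that the sage `v` writes when the hats are placed as `c` -/
  guess : ∀ v : V, 𝒢.Placement → Finset (Fin (𝒢.hatness v))
  card_le : ∀ (v : V) (c : 𝒢.Placement), (guess v c).card ≤ 𝒢.guesses v
  depends_only_on_neighbors : ∀ (v : V) (c c' : 𝒢.Placement),
    (∀ w, 𝒢.graph.Adj v w → c w = c' w) → guess v c = guess v c'

/-- A strategy is winning if for every hat placement at least one sage guesses the color of the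
own hat. -/
def Game.Strategy.IsWinning {V : Type*} {𝒢 : Game V} (f : 𝒢.Strategy) : Prop :=
  ∀ c : 𝒢.Placement, ∃ v : V, c v ∈ f.guess v c

/-- A game is winning if the sages have a winning strategy in it. -/
def Game.IsWinning {V : Type*} (𝒢 : Game V) : Prop :=
  ∃ f : 𝒢.Strategy, f.IsWinning

/-- The hat guessing number `HG_s(G)`: the largest `k` such that the game `⟨G, k, s⟩` with
constant hatness `k` and constant guessing number `s` is winning. The value is taken in `ℕ∞`, so
it is `⊤` if there are arbitrarily large such `k`; otherwise the supremum is a maximum. -/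
noncomputable def HG (s : ℕ) {V : Type*} (G : SimpleGraph V) : ℕ∞ :=
  ⨆ (k : ℕ) (_ : Game.IsWinning ⟨G, fun _ => k, fun _ => s⟩), (k : ℕ∞)

/-- A class of graphs. -/
abbrev GraphClass : Type 1 := ∀ V : Type, SimpleGraph V → Prop

/-- The hat guessing number of a class of graphs, `HG_s(𝒞) = sup {HG_s(G) : G ∈ 𝒞}`. -/
noncomputable def classHG (s : ℕ) (𝒞 : GraphClass) : ℕ∞ :=
  ⨆ (V : Type) (G : SimpleGraph V) (_ : 𝒞 V G), HG s G

/-- The petal graph `Pe_n`: the path on the `n` vertices `some 0, …, some (n - 1)` together with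
the stem `none`, which is adjacent to every vertex of the path. -/
def petal (n : ℕ) : SimpleGraph (Option (Fin n)) where
  Adj
    | none, none => False
    | none, some _ => True
    | some _, none => True
    | some i, some j => (SimpleGraph.pathGraph n).Adj i j
  symm := ⟨by
    rintro (_ | i) (_ | j) h
    · exact h
    · trivial
    · trivial
    · exact h.symm⟩
  loopless := ⟨by
    rintro (_ | i) h
    · exact h
    · exact (SimpleGraph.pathGraph n).loopless.irrefl i h⟩

/-- The class of all petals: the graphs isomorphic to `Pe_n` for some `n ≥ 1`. -/
def Petal : GraphClass := fun _ G =>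
  ∃ n : ℕ, 1 ≤ n ∧ Nonempty (G ≃g petal n)

end Hats

namespace Hats

open Finset

/-! Put `g = s * (s + 1)`. The petal with `s` guesses behaves like a long path with `g` guesses,
whose threshold is `4 * g - 2` colors. Sages lose above it: fix `s + 1` stem colors and let each
path sage merge the guesses made under all of them, at most `g` in total. A path coloring defeating
the merged guesses exists (`exists_path_coloring_avoiding`), and the stem, with `s` guesses, misses
one of the fixed colors. Sages win at it: an explicit cyclic-interval strategy with `g` guesses wins
on a path of `k` sages (`card_pathGuess_le`, `exists_mem_pathGuess`). Giving each `(s + 1)`-tuple of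
stem colors its own segment and splitting the `g` guesses into `s + 1` shares, one per color of the
tuple, leaves the stem at most `s` colors to guess. -/

/-- Winning with constant hatness and constant guessing number is invariant under graph
isomorphism. -/
theorem Game.IsWinning.of_iso {V W : Type*} {G : SimpleGraph V} {H : SimpleGraph W} (e : G ≃g H)
    {k s : ℕ} (hG : Game.IsWinning ⟨G, fun _ => k, fun _ => s⟩) :
    Game.IsWinning ⟨H, fun _ => k, fun _ => s⟩ := by
  obtain ⟨f, hf⟩ := hG
  refine ⟨⟨fun w c => f.guess (e.symm w) (fun v => c (e v)), fun w c => f.card_le _ _, ?_⟩, ?_⟩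
  · intro w c c' h
    refine f.depends_only_on_neighbors _ _ _ fun v hv => h _ ?_
    have := e.map_adj_iff.2 hv
    simpa using this
  · intro c
    obtain ⟨v, hv⟩ := hf fun v => c (e v)
    refine ⟨e v, ?_⟩
    have key : ∀ u, u = v → c (e v) ∈ f.guess u (fun v => c (e v)) := by
      rintro u rfl
      exact hv
    exact key _ (e.symm_apply_apply v)

/-! ### Upper bound: defeating paths, then petals -/

/-- A path on which every sage makes at most `g` guesses of `k ≥ 4 g - 1` colors loses; moreover,
for each color of the next hat there are more than `k - 2 g` possible colors of the last hat. -/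
theorem exists_path_coloring_avoiding {k g : ℕ} (hg : 1 ≤ g) (hk : 4 * g ≤ k + 1)
    (U : ℕ → Fin k → Fin k → Finset (Fin k)) (hU : ∀ i x z, (U i x z).card ≤ g) (n : ℕ)
    (z : Fin k) :
    ∃ B : Finset (Fin k), k + 1 ≤ B.card + 2 * g ∧ ∀ y ∈ B, ∃ c : ℕ → Fin k,
      c n = y ∧ c (n + 1) = z ∧ ∀ i < n, c (i + 1) ∉ U i (c i) (c (i + 2)) := by
  induction n generalizing z with
  | zero =>
    refine ⟨univ, by simp; omega, fun y _ => ⟨fun i => if i = 0 then y else z, ?_⟩⟩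
    simp
  | succ n ih =>
    choose B hB hc using ih
    -- `K` holds the colors that no admissible `x` can precede. Double counting pairs `(x, y)` with
    -- `x ∈ B y` bounds it: each `x` serves at most `g` colors `y`.
    set K : Finset (Fin k) := univ.filter fun y => ∀ x ∈ B y, y ∈ U n x z with hK
    refine ⟨Kᶜ, ?_, ?_⟩
    · have h1 : K.card * (k + 1 - 2 * g) ≤ k * g := by
        calc K.card * (k + 1 - 2 * g) ≤ ∑ y ∈ K, (B y).card := by
              rw [← smul_eq_mul]
              exact Finset.card_nsmul_le_sum _ _ _ fun y _ => by have := hB y; omega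
          _ = ∑ y ∈ K, (univ.filter fun x => x ∈ B y).card := by simp
          _ = ∑ x, (K.filter fun y => x ∈ B y).card :=
              Finset.sum_card_bipartiteAbove_eq_sum_card_bipartiteBelow fun y x => x ∈ B y
          _ ≤ ∑ _x : Fin k, g := by
              refine Finset.sum_le_sum fun x _ => (Finset.card_le_card ?_).trans (hU n x z)
              intro y hy
              rw [mem_filter, hK, mem_filter] at hy
              exact hy.1.2 x hy.2
          _ = k * g := by simp
      have h2 : K.card < 2 * g := by
        by_contra! h
        obtain ⟨m, hm⟩ : ∃ m, k + 1 = m + 2 * g := ⟨k + 1 - 2 * g, by omega⟩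
        rw [hm, Nat.add_sub_cancel] at h1
        -- Since `4 * g ≤ k + 1` gives `k + 1 ≤ 2 * m`, having `2 * g` blocked colors would force `g
        -- * (k + 1) ≤ g * k`.
        have h3 := Nat.mul_le_mul_right m h
        have h4 : g * (k + 1) ≤ g * (2 * m) := Nat.mul_le_mul_left g (by omega)
        nlinarith
      rw [Finset.card_compl, Fintype.card_fin]
      omega
    · intro y hy
      simp only [hK, mem_compl, mem_filter, mem_univ, true_and, not_forall] at hy
      obtain ⟨x, hx, hxy⟩ := hy
      obtain ⟨c, rfl, rfl, h⟩ := hc y x hx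
      refine ⟨Function.update c (n + 2) z, by simp, by simp, fun i hi => ?_⟩
      rcases Nat.lt_succ_iff_lt_or_eq.1 hi with hi | rfl
      · rw [Function.update_of_ne (by omega), Function.update_of_ne (by omega),
          Function.update_of_ne (by omega)]
        exact h i hi
      · rw [Function.update_self, Function.update_of_ne (by omega),
          Function.update_of_ne (by omega)]
        exact hxy

/-- With `s` guesses the sages lose on every petal if there are at least `4 s (s + 1) - 1`
colors. -/
theorem not_isWinning_petal {s k n : ℕ} (hs : 1 ≤ s) (hk : 4 * (s * (s + 1)) ≤ k + 1) :
    ¬ Game.IsWinning ⟨petal n, fun _ => k, fun _ => s⟩ := by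
  rintro ⟨f, hf⟩
  have hsk : s + 1 ≤ k := by nlinarith
  obtain ⟨S, hS⟩ : ∃ S : Finset (Fin k), S.card = s + 1 := by
    obtain ⟨S, -, hS⟩ := Finset.exists_subset_card_eq (s := (univ : Finset (Fin k)))
      (n := s + 1) (by simpa using hsk)
    exact ⟨S, hS⟩
  let P : Fin k → (Fin n → Fin k) → Option (Fin n) → Fin k := fun a c v => v.elim a c
  let U : ℕ → Fin k → Fin k → Finset (Fin k) := fun i x z =>
    if h : i < n then S.biUnion fun a =>
      f.guess (some ⟨i, h⟩) (P a fun j => if (j : ℕ) < i then x else z)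
    else ∅
  have hU : ∀ i x z, (U i x z).card ≤ s * (s + 1) := by
    intro i x z
    by_cases h : i < n
    · simp only [U, dif_pos h]
      refine (Finset.card_biUnion_le_card_mul _ _ s fun a _ => f.card_le _ _).trans ?_
      rw [hS, mul_comm]
    · simp [U, h]
  obtain ⟨B, hB, hc⟩ := exists_path_coloring_avoiding (by nlinarith) hk U hU n ⟨0, by omega⟩
  obtain ⟨y, hy⟩ : B.Nonempty := by
    rw [← Finset.card_pos]
    have : 1 ≤ s * (s + 1) := by nlinarith
    omega
  obtain ⟨c, -, -, h⟩ := hc y hy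
  -- Sage `j` wears `c (j + 1)`; `c 0` and `c (n + 1)` are dummy hats beyond the ends.
  let d : Fin n → Fin k := fun j => c (j + 1)
  obtain ⟨a₀, -⟩ : S.Nonempty := by rw [← Finset.card_pos]; omega
  obtain ⟨a, haS, ha⟩ : ∃ a ∈ S, a ∉ f.guess none (P a₀ d) := by
    by_contra! hcon
    have h1 := Finset.card_le_card (s := S) (t := f.guess none (P a₀ d)) hcon
    have h2 := f.card_le none (P a₀ d)
    simp only at h2
    omega
  obtain ⟨v, hv⟩ := hf (P a d)
  rcases v with _ | i
  · rw [f.depends_only_on_neighbors none (P a d) (P a₀ d)] at hv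
    · exact ha hv
    · rintro (_ | j) hj
      · exact hj.elim
      · rfl
  · refine h i i.2 ?_
    simp only [U, dif_pos i.2, mem_biUnion]
    refine ⟨a, haS, ?_⟩
    rw [f.depends_only_on_neighbors (some i) (P a d)
      (P a fun j => if (j : ℕ) < i then c i else c (i + 2))] at hv
    · exact hv
    · rintro (_ | j) hj
      · rfl
      · have hj' : (SimpleGraph.pathGraph n).Adj i j := hj
        rw [SimpleGraph.pathGraph_adj] at hj'
        change c (j + 1) = if (j : ℕ) < i then c i else c (i + 2)
        rcases hj' with hj' | hj'
        · rw [if_neg (by omega), ← hj']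
        · rw [if_pos (by omega), hj']

/-! ### Lower bound: the cyclic-interval strategy on a path -/

/-- The guesses of a sage on a path of `k` sages, if the hats of the left and of the right
neighbor have the colors `x` and `z`: those colors `y` for which `x` lies in the cyclic interval
`[m y, m y + m)` while `y` does not lie in `[(m - 1) z, (m - 1) z + (m - 1))`. -/
noncomputable def pathGuess (k m x z : ℕ) : Finset (Fin k) :=
  open Classical in
  univ.filter fun y : Fin k => (∃ r < m, m * y + r ≡ x [MOD k]) ∧
    ¬ ∃ r < m - 1, (m - 1) * z + r ≡ y [MOD k]

theorem mem_pathGuess {k m x z : ℕ} {y : Fin k} :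
    y ∈ pathGuess k m x z ↔ (∃ r < m, m * y + r ≡ x [MOD k]) ∧
      ¬ ∃ r < m - 1, (m - 1) * z + r ≡ y [MOD k] := by
  simp [pathGuess]

theorem exists_lt_add_modEq {k : ℕ} (hk : 0 < k) (a b : ℕ) : ∃ r < k, a + r ≡ b [MOD k] := by
  refine ⟨(b + (k - a % k)) % k, Nat.mod_lt _ hk, ?_⟩
  have h : a % k ≤ k := (Nat.mod_lt _ hk).le
  calc a + (b + (k - a % k)) % k ≡ a % k + (b + (k - a % k)) [MOD k] :=
        (Nat.mod_modEq _ _).symm.add (Nat.mod_modEq _ _)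
    _ = b + k := by omega
    _ ≡ b [MOD k] := by simp [Nat.ModEq]

/-- The candidates `y` lie among `k - m + 1` cyclically consecutive colors, and their intervals `[m
y, m y + m)` are laid end to end. Their total length is at most `g * k`, so they wind around the
circle at most `g` times and cover `x` at most `g` times. -/
theorem card_pathGuess_le {k m g : ℕ} (x z : ℕ) (hm : 1 ≤ m) (hmk : m ≤ k)
    (h : m * (k - m + 1) ≤ g * k) : (pathGuess k m x z).card ≤ g := by
  have hk : 0 < k := by omega
  set b := (m - 1) * z + (m - 1) with hb
  have key : ∀ y : Fin k, ∃ t r : ℕ, y ∈ pathGuess k m x z →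
      t < k - m + 1 ∧ r < m ∧ b + t ≡ y [MOD k] ∧ m * b + (m * t + r) ≡ x [MOD k] := by
    intro y
    by_cases hy : y ∈ pathGuess k m x z
    · obtain ⟨⟨r, hr, hrx⟩, hz⟩ := mem_pathGuess.1 hy
      obtain ⟨r', hr', hy'⟩ := exists_lt_add_modEq hk ((m - 1) * z) y
      have hle : m - 1 ≤ r' := by
        by_contra! hlt
        exact hz ⟨r', hlt, hy'⟩
      have hbt : b + (r' - (m - 1)) ≡ y [MOD k] := by
        rw [hb, show (m - 1) * z + (m - 1) + (r' - (m - 1)) = (m - 1) * z + r' by omega]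
        exact hy'
      refine ⟨r' - (m - 1), r, fun _ => ⟨by omega, hr, hbt, ?_⟩⟩
      rw [← add_assoc, ← mul_add]
      exact ((hbt.mul_left m).add_right r).trans hrx
    · exact ⟨0, 0, fun h => (hy h).elim⟩
  choose t r hkey using key
  have hdiv : ∀ y ∈ pathGuess k m x z, (m * t y + r y) / k < g := by
    intro y hy
    obtain ⟨ht, hr, -, -⟩ := hkey y hy
    rw [Nat.div_lt_iff_lt_mul hk]
    have := Nat.mul_le_mul_left m (Nat.succ_le_of_lt ht)
    rw [Nat.mul_succ] at this
    omega
  rw [← Finset.card_range g]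
  refine Finset.card_le_card_of_injOn (fun y => (m * t y + r y) / k)
    (fun y hy => by simpa using hdiv y hy) ?_
  intro y hy y' hy' heq
  obtain ⟨-, hr, hb1, hx1⟩ := hkey y hy
  obtain ⟨-, hr', hb2, hx2⟩ := hkey y' hy'
  have hmod : (m * t y + r y) % k = (m * t y' + r y') % k :=
    Nat.ModEq.add_left_cancel' _ (hx1.trans hx2.symm)
  have hw : m * t y + r y = m * t y' + r y' := by
    rw [← Nat.div_add_mod (m * t y + r y) k, ← Nat.div_add_mod (m * t y' + r y') k, hmod]
    simp only at heq
    rw [heq]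
  have ht : t y = t y' := by
    have := congrArg (· / m) hw
    simpa [Nat.mul_add_div (show 0 < m by omega), Nat.div_eq_of_lt hr, Nat.div_eq_of_lt hr']
      using this
  have hyy : (y : ℕ) ≡ y' [MOD k] := by
    rw [ht] at hb1
    exact hb1.symm.trans hb2
  exact Fin.ext (hyy.eq_of_lt_of_lt y.2 y'.2)

/-- On every segment of `k` consecutive sages of a path, some sage guesses correctly. -/
theorem exists_mem_pathGuess {k : ℕ} (c : ℕ → Fin k) (x : ℕ → ℕ) (hx : ∀ i, x (i + 1) = c i) :
    ∃ i, ∃ _ : i < k, c i ∈ pathGuess k (k - i) (x i) (c (i + 1)) := by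
  have hk : 0 < k := (c 0).pos
  by_contra! hcon
  -- If all guesses fail, the previous hat stays in an interval of length `k - i` fixed by `c i`:
  -- the whole circle at `i = 0`, empty at `i = k`. Hence neither hat bordering the segment matters.
  have key : ∀ i ≤ k, ∃ r < k - i, (k - i) * (c i : ℕ) + r ≡ x i [MOD k] := by
    intro i
    induction i with
    | zero =>
      intro _
      exact exists_lt_add_modEq hk _ (x 0)
    | succ i ih =>
      intro hi
      have h := hcon i (by omega)
      rw [mem_pathGuess, not_and_not_right] at h
      rw [hx]
      exact h (ih (by omega))
  obtain ⟨r, hr, -⟩ := key k le_rfl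
  omega

/-! ### Lower bound: gluing segments to the stem -/

/-- A finite set of at most `t * s` elements is covered by `t` sets of at most `s` elements. -/
theorem exists_cover_of_card_le {α : Type*} [DecidableEq α] (s t : ℕ) (F : Finset α)
    (hF : F.card ≤ t * s) :
    ∃ P : ℕ → Finset α, (∀ r, (P r).card ≤ s) ∧ ∀ y ∈ F, ∃ r < t, y ∈ P r := by
  induction t generalizing F with
  | zero =>
    have : F = ∅ := by simpa using hF
    exact ⟨fun _ => ∅, by simp, by simp [this]⟩
  | succ t ih =>
    obtain ⟨E, hE, hcard⟩ := Finset.exists_subset_card_eq (s := F) (n := min s F.card)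
      (min_le_right _ _)
    have hsd : (F \ E).card ≤ t * s := by
      rw [Finset.card_sdiff_of_subset hE, hcard]
      rw [Nat.succ_mul] at hF
      omega
    obtain ⟨P, hP, hcov⟩ := ih (F \ E) hsd
    refine ⟨Function.update P t E, fun r => ?_, fun y hy => ?_⟩
    · rcases eq_or_ne r t with rfl | hr
      · rw [Function.update_self]; omega
      · rw [Function.update_of_ne hr]; exact hP r
    · by_cases hyE : y ∈ E
      · exact ⟨t, by omega, by rwa [Function.update_self]⟩
      · obtain ⟨r, hr, hyr⟩ := hcov y (by simp [hy, hyE])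
        exact ⟨r, by omega, by rwa [Function.update_of_ne (by omega)]⟩

/-- With `s` guesses and `k` colors the sages win on every sufficiently long petal if
`m (k - m + 1) ≤ s (s + 1) k` for all `1 ≤ m ≤ k`. -/
theorem isWinning_petal {s k n : ℕ} (hk : 0 < k)
    (h : ∀ m, 1 ≤ m → m ≤ k → m * (k - m + 1) ≤ (s + 1) * s * k)
    (hn : Fintype.card (Fin (s + 1) → Fin k) * k ≤ n) :
    Game.IsWinning ⟨petal n, fun _ => k, fun _ => s⟩ := by
  classical
  let T := Fintype.equivFin (Fin (s + 1) → Fin k)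
  have hcov : ∀ i x z : ℕ, ∃ P : ℕ → Finset (Fin k), (∀ r, (P r).card ≤ s) ∧
      (i < k → ∀ y ∈ pathGuess k (k - i) x z, ∃ r < s + 1, y ∈ P r) := by
    intro i x z
    by_cases hi : i < k
    · obtain ⟨P, hP, hP'⟩ := exists_cover_of_card_le s (s + 1) (pathGuess k (k - i) x z)
        (card_pathGuess_le x z (by omega) (by omega) (h _ (by omega) (by omega)))
      exact ⟨P, hP, fun _ => hP'⟩
    · exact ⟨fun _ => ∅, by simp, fun h => (hi h).elim⟩
  choose Q hQ hQ' using hcov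
  -- the colors along the path, continued by `0` beyond its ends
  let right : (Option (Fin n) → Fin k) → ℕ → Fin k := fun c p =>
    if hp : p < n then c (some ⟨p, hp⟩) else ⟨0, hk⟩
  let left : (Option (Fin n) → Fin k) → ℕ → ℕ := fun c p =>
    if p = 0 then 0 else right c (p - 1)
  -- a sage of the segment belonging to the tuple `t` plays the share of the color of the stem
  let share : (Option (Fin n) → Fin k) → ℕ → Fin k → Finset (Fin k) := fun c p a =>
    if hq : p / k < Fintype.card (Fin (s + 1) → Fin k) then
      if ha : ∃ r, T.symm ⟨p / k, hq⟩ r = a then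
        Q (p % k) (left c p) (right c (p + 1)) ha.choose
      else ∅
    else ∅
  have hshare : ∀ c p a, (share c p a).card ≤ s := by
    intro c p a
    simp only [share]
    split_ifs <;> simp [hQ]
  let stem : (Option (Fin n) → Fin k) → Finset (Fin k) := fun c =>
    univ.filter fun a => ∀ i : Fin n, c (some i) ∉ share c i a
  have hstem : ∀ c, (stem c).card ≤ s := by
    intro c
    -- Enumerate `s + 1` surviving stem colors as a tuple `t`. In the segment of `t` some sage's
    -- full guess set is right, so one share is right, and its stem color should not have survived.
    by_contra! hlt
    obtain ⟨S, hS, hcard⟩ := Finset.exists_subset_card_eq (Nat.succ_le_of_lt hlt)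
    let t : Fin (s + 1) → Fin k := S.orderEmbOfFin hcard
    have ht : Function.Injective t := (S.orderEmbOfFin hcard).injective
    let q := T t
    obtain ⟨i, hi, hmem⟩ := exists_mem_pathGuess (fun i => right c (q * k + i))
      (fun i => left c (q * k + i)) (fun i => by simp [left, ← add_assoc])
    obtain ⟨r, hr, hmem⟩ := hQ' i _ _ hi _ hmem
    have hpn : q * k + i < n := by
      have := Nat.mul_le_mul_right k (Nat.succ_le_of_lt q.2)
      rw [Nat.succ_mul] at this
      omega
    have hdiv : ((q : ℕ) * k + i) / k = q := by
      rw [mul_comm, Nat.mul_add_div hk, Nat.div_eq_of_lt hi, add_zero]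
    have hmod : ((q : ℕ) * k + i) % k = i := by
      rw [mul_comm, Nat.mul_add_mod, Nat.mod_eq_of_lt hi]
    have hta : t ⟨r, hr⟩ ∈ stem c := hS (Finset.orderEmbOfFin_mem S hcard _)
    refine (mem_filter.1 hta).2 ⟨q * k + i, hpn⟩ ?_
    have hq : ((q : ℕ) * k + i) / k < Fintype.card (Fin (s + 1) → Fin k) := by
      rw [hdiv]; exact q.2
    have hTq : T.symm ⟨((q : ℕ) * k + i) / k, hq⟩ = t := by
      rw [Equiv.symm_apply_eq]
      exact Fin.ext hdiv
    have hex : ∃ r', T.symm ⟨((q : ℕ) * k + i) / k, hq⟩ r' = t ⟨r, hr⟩ := ⟨⟨r, hr⟩, by rw [hTq]⟩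
    have hch : hex.choose = ⟨r, hr⟩ := by
      exact ht ((congrFun hTq _).symm.trans hex.choose_spec)
    simp only [share]
    rw [dif_pos hq, dif_pos hex, hch, hmod]
    simpa [right, hpn, add_assoc] using hmem
  let guess : ∀ _v : Option (Fin n), (Option (Fin n) → Fin k) → Finset (Fin k) := fun v c =>
    v.elim (stem c) fun i => share c i (c none)
  have hadj : ∀ (i : Fin n) (c c' : Option (Fin n) → Fin k),
      (∀ w, (petal n).Adj (some i) w → c w = c' w) → ∀ a, share c i a = share c' i a := by
    intro i c c' hcc a
    have hr : right c (i + 1) = right c' (i + 1) := by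
      simp only [right]
      split_ifs with hp
      · refine hcc _ ?_
        change (SimpleGraph.pathGraph n).Adj i _
        simp [SimpleGraph.pathGraph_adj]
      · rfl
    have hl : left c i = left c' i := by
      simp only [left, right]
      split_ifs with h0 hp
      · rfl
      · congr 1
        refine hcc _ ?_
        change (SimpleGraph.pathGraph n).Adj i _
        simp only [SimpleGraph.pathGraph_adj]
        omega
      · rfl
    simp only [share, hr, hl]
  refine ⟨⟨guess, ?_, ?_⟩, ?_⟩
  · rintro (_ | i) c
    · exact hstem c
    · exact hshare c i _
  · rintro (_ | i) c c' hcc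
    · have hpath : ∀ i : Fin n, c (some i) = c' (some i) := fun i => hcc (some i) trivial
      have hright : right c = right c' := by
        funext p
        simp only [right, hpath]
      change stem c = stem c'
      simp only [stem, share, left, hright, hpath]
    · change share c i (c none) = share c' i (c' none)
      rw [hadj i c c' hcc, hcc none trivial]
  · intro c
    by_cases hc : ∃ i : Fin n, c (some i) ∈ share c i (c none)
    · obtain ⟨i, hi⟩ := hc
      exact ⟨some i, hi⟩
    · push Not at hc
      exact ⟨none, mem_filter.2 ⟨mem_univ _, hc⟩⟩

theorem HG_petal_le {s : ℕ} (hs : 1 ≤ s) (n : ℕ) :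
    HG s (petal n) ≤ ((4 * s * (s + 1) - 2 : ℕ) : ℕ∞) := by
  refine iSup₂_le fun k hk => ?_
  by_contra! hlt
  rw [Nat.cast_lt, mul_assoc] at hlt
  exact not_isWinning_petal hs (by omega) hk

/-- With `k = 4 * g - 2` the required inequality is `(m - (2 * g - 1)) * (m - 2 * g) ≥ 0`, true
because no integer lies strictly between the roots. -/
theorem le_HG_petal {s n : ℕ} (hs : 1 ≤ s)
    (hn : Fintype.card (Fin (s + 1) → Fin (4 * s * (s + 1) - 2)) * (4 * s * (s + 1) - 2) ≤ n) :
    ((4 * s * (s + 1) - 2 : ℕ) : ℕ∞) ≤ HG s (petal n) := by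
  refine le_iSup₂_of_le (4 * s * (s + 1) - 2) (isWinning_petal ?_ ?_ hn) le_rfl
  · have : 1 ≤ s * (s + 1) := by nlinarith
    rw [mul_assoc]
    omega
  · intro m _ hm
    obtain ⟨g, hg⟩ : ∃ g, g = s * (s + 1) := ⟨_, rfl⟩
    have hg1 : 1 ≤ g := by nlinarith
    rw [mul_assoc 4, ← hg] at hm ⊢
    rw [mul_comm (s + 1), ← hg]
    zify [hm, show 2 ≤ 4 * g by omega]
    rcases le_or_gt m (2 * g - 1) with h | h
    · have h1 : (0 : ℤ) ≤ 2 * g - 1 - m := by omega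
      nlinarith
    · have h1 : (0 : ℤ) ≤ m - 2 * g := by omega
      nlinarith

theorem HG_le_of_iso {V W : Type*} {G : SimpleGraph V} {H : SimpleGraph W} (e : G ≃g H) (s : ℕ) :
    HG s G ≤ HG s H :=
  iSup₂_le fun k hk => le_iSup₂_of_le k (hk.of_iso e) le_rfl

end Hats

theorem mainTheorem2 (s : ℕ) (hs : 1 ≤ s) :
    Hats.classHG s Hats.Petal = ((4 * s * (s + 1) - 2 : ℕ) : ℕ∞) ∧
    (∀ n : ℕ, 1 ≤ n → Hats.HG s (Hats.petal n) < ((4 * s * (s + 1) - 1 : ℕ) : ℕ∞)) ∧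
    (∃ N : ℕ, ∀ n : ℕ, N ≤ n →
      Hats.HG s (Hats.petal n) = ((4 * s * (s + 1) - 2 : ℕ) : ℕ∞)) := by
  have hpos : 1 ≤ s * (s + 1) := by nlinarith
  refine ⟨le_antisymm ?_ ?_, fun n _ => (Hats.HG_petal_le hs n).trans_lt ?_,
    _, fun n hn => le_antisymm (Hats.HG_petal_le hs n) (Hats.le_HG_petal hs hn)⟩
  · refine iSup_le fun V => iSup_le fun G => iSup_le ?_
    rintro ⟨n, -, ⟨e⟩⟩
    exact (Hats.HG_le_of_iso e s).trans (Hats.HG_petal_le hs n)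
  -- Passing to the successor of the bound makes the petal length visibly positive.
  · refine (Hats.le_HG_petal hs (Nat.le_succ _)).trans ?_
    refine le_iSup_of_le _ (le_iSup_of_le _ (le_iSup_of_le ?_ le_rfl))
    exact ⟨_, Nat.succ_pos _, ⟨SimpleGraph.Iso.refl⟩⟩
  · rw [Nat.cast_lt, mul_assoc]
    omega
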